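/- **Setting.** For a finite simple vertex-transitive graph $G$ with $V$ vertices and degree $m$, retain each edge independently with probability $p\in[0,1]$; write $\mathbf P_p,\mathbb E_p$ for the resulting law and expectation, $x\leftrightarrow y$ if $x$ and $y$ are joined by a path of retained edges, $\mathcal C(x)$ for the set of vertices $y$ with $x\leftrightarrow y$, and $\chi(p)=\mathbb E_p|\mathcal C(o)|$, where $o$ is any vertex. Let $p_c\in[0,1]$ be the solution of $\chi(p_c)=\tfrac1{10}V^{1/3}$, and put $$\nabla_p(x,y)=\sum_{u,v}\mathbf P_p(x\leftrightarrow u)\,\mathbf P_p(u\leftrightarrow v)\,\mathbf P_p(v\leftrightarrow y).$$ Let $\mathbf p^t(x,y)$ be the probability that the non-backtracking random walk started at $x$ is at $y$ at time $t$ (the first step is to a uniform neighbour, every later step to a uniform neighbour other than the vertex just left). For $\delta\in\mathbb R$ the uniform mixing time is $$T_{\rm mix}=T_{\rm mix}(\delta)=\min\Big\{t\ge 0:\ \max_{x,y}\frac{\mathbf p^t(x,y)+\mathbf p^{t+1}(x,y)}2\le(1+\delta)V^{-1}\Big\}.$$ **Theorem.** There is an absolute constant $C>0$ such that the following holds. Let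 $(G_n)_{n\ge0}$ be a sequence of finite simple vertex-transitive graphs with degrees $m=m_n$ and numbers of vertices $V=V_n$, and let $\delta_n\to0$. Assume that for all large $n$ the critical value $p_c=p_c(G_n)$ and the mixing time $T_{\rm mix}=T_{\rm mix}(\delta_n)$ of $G_n$ exist, and that, as $n\to\infty$, 1. $m\to\infty$, 2. $[p_c(m-1)]^{T_{\rm mix}}=1+o(1)$, 3. uniformly in the vertices $x,y$ of $G_n$, $$\sum_{u,v}\ \sum_{\substack{0\le t_1,t_2,t_3\le T_{\rm mix}\\ t_1+t_2+t_3\ge3}}\mathbf p^{t_1}(x,u)\,\mathbf p^{t_2}(u,v)\,\mathbf p^{t_3}(v,y)\ \le\ o(1/\log V).$$ Then the strong triangle condition holds: there is a sequence $e_n\to0$ such that for all large $n$, all $p\in[0,p_c]$ and all vertices $x,y$ of $G_n$, $$\nabla_p(x,y)\le \mathbf 1_{\{x=y\}}+\frac{C\,\chi(p)^3}{V}+e_n .$$ -/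

import Mathlib

open Filter Topology

noncomputable section

namespace FiniteGraph

/-- Vertex-transitivity: the automorphism group acts transitively on the vertices. -/
def IsTransitive {V : Type*} (G : SimpleGraph V) : Prop :=
  ∀ x y : V, ∃ φ : G ≃g G, φ x = y

open Classical in
/-- Every vertex has degree `m`. -/
def HasDegree {V : Type*} [Fintype V] (G : SimpleGraph V) (m : ℕ) : Prop :=
  G.IsRegularOfDegree m

/-! ### Bond percolation -/

open Classical in
/-- The expectation `𝔼_p f` for bond percolation on the finite graph `G`. A configuration is the
set `ω` of open (retained) edges; as the edges are retained independently with probability `p`,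
the configuration `ω` has probability `p ^ |ω| (1 - p) ^ |E ∖ ω|`. -/
def percExp {V : Type*} [Fintype V] (G : SimpleGraph V) (p : ℝ)
    (f : Finset (Sym2 V) → ℝ) : ℝ :=
  ∑ ω ∈ G.edgeFinset.powerset, p ^ ω.card * (1 - p) ^ (G.edgeFinset \ ω).card * f ω

open Classical in
/-- The probability `𝐏_p(A)` of an event `A`. -/
def percProb {V : Type*} [Fintype V] (G : SimpleGraph V) (p : ℝ)
    (A : Finset (Sym2 V) → Prop) : ℝ :=
  percExp G p (fun ω => if A ω then 1 else 0)

/-- `x ↔ y` in the configuration `ω`: there is a path from `x` to `y` all of whose edges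
are open. -/
def Connects {V : Type*} (ω : Finset (Sym2 V)) (x y : V) : Prop :=
  (SimpleGraph.fromEdgeSet (ω : Set (Sym2 V))).Reachable x y

/-- The cluster `𝒞(x)` in the configuration `ω`. -/
def cluster {V : Type*} (ω : Finset (Sym2 V)) (x : V) : Set V :=
  {y | Connects ω x y}

/-- The expected cluster size `χ(p) = 𝔼_p |𝒞(o)|` of the vertex `o`. -/
def chi {V : Type*} [Fintype V] (G : SimpleGraph V) (o : V) (p : ℝ) : ℝ :=
  percExp G p (fun ω => ((cluster ω o).ncard : ℝ))

/-- The triangle diagram `∇_p(x, y) = ∑_{u,v} 𝐏_p(x ↔ u) 𝐏_p(u ↔ v) 𝐏_p(v ↔ y)`. -/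
def triangle {V : Type*} [Fintype V] (G : SimpleGraph V) (p : ℝ) (x y : V) : ℝ :=
  ∑ u : V, ∑ v : V,
    percProb G p (fun ω => Connects ω x u) * percProb G p (fun ω => Connects ω u v) *
      percProb G p (fun ω => Connects ω v y)

/-- `p` is the critical probability `p_c(lam)`: the solution `p ∈ [0, 1]` of
`𝔼_p |𝒞(o)| = lam V^{1/3}`. -/
def IsCriticalProb {V : Type*} [Fintype V] (G : SimpleGraph V) (o : V) (lam p : ℝ) : Prop :=
  p ∈ Set.Icc (0 : ℝ) 1 ∧ chi G o p = lam * (Fintype.card V : ℝ) ^ (1 / 3 : ℝ)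

/-! ### The non-backtracking random walk -/

open Classical in
/-- The probability that the non-backtracking walk, which has just stepped from `w` to `x`, is at
`y` after `t` further steps: each step is to a uniformly chosen neighbour other than the vertex
just left. -/
def nbwFrom {V : Type*} [Fintype V] (G : SimpleGraph V) : ℕ → V → V → V → ℝ
  | 0, _, x, y => if x = y then 1 else 0
  | t + 1, w, x, y =>
      ∑ z ∈ (G.neighborFinset x).erase w,
        (1 / (((G.neighborFinset x).erase w).card : ℝ)) * nbwFrom G t x z y

open Classical in
/-- `𝐩^t(x, y)`: the probability that the non-backtracking walk started at `x` is at `y` at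
time `t`. The first step is to a uniformly chosen neighbour of `x`. -/
def nbw {V : Type*} [Fintype V] (G : SimpleGraph V) : ℕ → V → V → ℝ
  | 0, x, y => if x = y then 1 else 0
  | t + 1, x, y =>
      ∑ z ∈ G.neighborFinset x, (1 / ((G.neighborFinset x).card : ℝ)) * nbwFrom G t x z y

/-- `T` is the uniform mixing time of the non-backtracking walk with tolerance `δ`, that is
`T = min {t : max_{x,y} (𝐩^t(x,y) + 𝐩^{t+1}(x,y)) / 2 ≤ (1 + δ) V⁻¹}`; in particular the set
of such `t` is non-empty. -/
def IsMixingTime {V : Type*} [Fintype V] (G : SimpleGraph V) (δ : ℝ) (T : ℕ) : Prop :=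
  IsLeast {t : ℕ | ∀ x y : V,
    (nbw G t x y + nbw G (t + 1) x y) / 2 ≤ (1 + δ) * (Fintype.card V : ℝ)⁻¹} T

/-- The sum over `u, v` and over `0 ≤ t₁, t₂, t₃ ≤ T` with `t₁ + t₂ + t₃ ≥ 3` of
`𝐩^{t₁}(x,u) 𝐩^{t₂}(u,v) 𝐩^{t₃}(v,y)`. -/
def nbwTriple {V : Type*} [Fintype V] (G : SimpleGraph V) (T : ℕ) (x y : V) : ℝ :=
  ∑ u : V, ∑ v : V,
    ∑ t ∈ (Finset.range (T + 1) ×ˢ Finset.range (T + 1) ×ˢ Finset.range (T + 1)).filter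
        (fun t => 3 ≤ t.1 + t.2.1 + t.2.2),
      nbw G t.1 x u * nbw G t.2.1 u v * nbw G t.2.2 v y

end FiniteGraph

end

/-! Write `τ` for the two-point function and cut it at path length `T`: either `x` and `y` are
joined by an open path of at most `T` steps, or there is a longer open path. In the long case, fix
the last `T` (or `T + 1`) edges of the path. The head is a connection off these edges, so
independence bounds the probability by `∑ z, τ x z` times the expected number of open paths of that
length from `z` to `y`. Counting paths by the non-backtracking walk and using `[p(m-1)]^t ≤ 2` for
`t ≤ T`, this number is a constant times `nbw`, which is of order `1/V` at the mixing time. Hence `τ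
≤ S + 16χ/V`, with `S` the short-path probability (`percProb_longPath_le_chi_div_card`). Replacing
the three factors `τ` of the triangle by `S` costs `16χ/V · χ²` each. The remaining sum of products
of `S` is bounded by convolutions of walks (`sum_shortPath_le`): all times zero give the indicator,
total time 1 or 2 gives `O(1/m)`, and the rest is at most a constant times `nbwTriple`. -/

namespace FiniteGraph

/-! ### Product Bernoulli measures on subsets of a finite set -/

section Bernoulli

variable {α : Type*} [DecidableEq α]

/-- The expectation of `f` over a random subset of `E` that contains each element independently
with probability `p`. -/
def bernoulliExp (E : Finset α) (p : ℝ) (f : Finset α → ℝ) : ℝ :=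
  ∑ ω ∈ E.powerset, p ^ ω.card * (1 - p) ^ (E \ ω).card * f ω

theorem bernoulliExp_insert {E : Finset α} {e : α} (he : e ∉ E) (p : ℝ) (f : Finset α → ℝ) :
    bernoulliExp (insert e E) p f =
      (1 - p) * bernoulliExp E p f + p * bernoulliExp E p (fun ω => f (insert e ω)) := by
  unfold bernoulliExp
  rw [Finset.sum_powerset_insert he, Finset.mul_sum, Finset.mul_sum]
  congr 1 <;> refine Finset.sum_congr rfl fun ω hω => ?_
  · have h : e ∉ ω := fun h => he (Finset.mem_powerset.1 hω h)
    rw [Finset.insert_sdiff_of_notMem _ h, Finset.card_insert_of_notMem (by simp [he])]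
    ring
  · have h : e ∉ ω := fun h => he (Finset.mem_powerset.1 hω h)
    rw [Finset.card_insert_of_notMem h, Finset.insert_sdiff_insert,
      Finset.sdiff_insert_of_notMem he]
    ring

theorem bernoulliExp_mono {E : Finset α} {p : ℝ} (hp : p ∈ Set.Icc (0 : ℝ) 1)
    {f g : Finset α → ℝ} (h : ∀ ω ⊆ E, f ω ≤ g ω) : bernoulliExp E p f ≤ bernoulliExp E p g :=
  Finset.sum_le_sum fun ω hω => mul_le_mul_of_nonneg_left (h ω (Finset.mem_powerset.1 hω))
    (mul_nonneg (pow_nonneg hp.1 _) (pow_nonneg (sub_nonneg.2 hp.2) _))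

theorem bernoulliExp_zero (E : Finset α) (p : ℝ) : bernoulliExp E p (fun _ => 0) = 0 := by
  simp [bernoulliExp]

theorem bernoulliExp_sum {ι : Type*} (s : Finset ι) (E : Finset α) (p : ℝ)
    (f : ι → Finset α → ℝ) :
    bernoulliExp E p (fun ω => ∑ i ∈ s, f i ω) = ∑ i ∈ s, bernoulliExp E p (f i) := by
  unfold bernoulliExp
  simp_rw [Finset.mul_sum]
  exact Finset.sum_comm

theorem bernoulliExp_one (E : Finset α) (p : ℝ) : bernoulliExp E p (fun _ => 1) = 1 := by
  induction E using Finset.induction_on with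
  | empty => simp [bernoulliExp]
  | insert e E he ih => rw [bernoulliExp_insert he, ih]; ring

/-- By independence the left side is `p` times the expectation of `h` over `E` without `e`;
restoring `e` only increases it, as `h` is monotone. -/
theorem bernoulliExp_mem_erase_le {E : Finset α} {p : ℝ} (hp : p ∈ Set.Icc (0 : ℝ) 1) {e : α}
    (he : e ∈ E) {h : Finset α → ℝ} (hm : Monotone h) :
    bernoulliExp E p (fun ω => if e ∈ ω then h (ω.erase e) else 0) ≤ p * bernoulliExp E p h := by
  obtain ⟨E, he', rfl⟩ : ∃ E', e ∉ E' ∧ insert e E' = E :=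
    ⟨E.erase e, Finset.notMem_erase e E, Finset.insert_erase he⟩
  rw [bernoulliExp_insert he', bernoulliExp_insert he']
  have h0 : bernoulliExp E p (fun ω => if e ∈ ω then h (ω.erase e) else 0) ≤ 0 := by
    refine (bernoulliExp_mono hp fun ω hω => ?_).trans_eq (bernoulliExp_zero E p)
    rw [if_neg fun h => he' (hω h)]
  have h1 : bernoulliExp E p
      (fun ω => if e ∈ insert e ω then h ((insert e ω).erase e) else 0) ≤ bernoulliExp E p h := by
    refine bernoulliExp_mono hp fun ω hω => ?_
    rw [if_pos (Finset.mem_insert_self e ω), Finset.erase_insert fun h => he' (hω h)]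
  have h2 : bernoulliExp E p h ≤ bernoulliExp E p (fun ω => h (insert e ω)) :=
    bernoulliExp_mono hp fun ω _ => hm (Finset.subset_insert e ω)
  have hp0 := hp.1
  have hp1 := sub_nonneg.2 hp.2
  nlinarith [mul_nonneg hp1 (neg_nonneg.2 h0), mul_nonneg hp0 (sub_nonneg.2 h1),
    mul_nonneg (mul_nonneg hp0 hp0) (sub_nonneg.2 h2)]

/-- Asking for all elements of `S` and, off `S`, for a monotone observable costs a factor
`p ^ |S|`. -/
theorem bernoulliExp_subset_sdiff_le {E : Finset α} {p : ℝ} (hp : p ∈ Set.Icc (0 : ℝ) 1)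
    {g : Finset α → ℝ} (hg : Monotone g) (hg0 : ∀ ω, 0 ≤ g ω) {S : Finset α} (hS : S ⊆ E) :
    bernoulliExp E p (fun ω => if S ⊆ ω then g (ω \ S) else 0) ≤
      p ^ S.card * bernoulliExp E p g := by
  induction S using Finset.induction_on with
  | empty => simp
  | insert e S he ih =>
    have ih := ih ((Finset.subset_insert e S).trans hS)
    -- The observable attached to `S` is again monotone (because `g ≥ 0`), so `e` can be peeled off
    -- it.
    have hm : Monotone fun ω : Finset α => if S ⊆ ω then g (ω \ S) else 0 := by
      intro a b hab
      dsimp only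
      split_ifs with ha hb hb
      · exact hg (Finset.sdiff_subset_sdiff hab subset_rfl)
      · exact absurd (ha.trans hab) hb
      · exact hg0 _
      · exact le_rfl
    have key := bernoulliExp_mem_erase_le hp (hS (Finset.mem_insert_self e S)) hm
    rw [Finset.card_insert_of_notMem he, pow_succ']
    calc _ ≤ _ := bernoulliExp_mono hp (fun ω _ => ?_)
      _ ≤ _ := key
      _ ≤ p * (p ^ S.card * bernoulliExp E p g) := mul_le_mul_of_nonneg_left ih hp.1
      _ = _ := by ring
    by_cases h : insert e S ⊆ ω
    · have h' := Finset.insert_subset_iff.1 h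
      have h3 : S ⊆ ω.erase e := Finset.subset_erase.2 ⟨h'.2, he⟩
      rw [if_pos h, if_pos h'.1, if_pos h3]
      have h4 : ω.erase e \ S = ω \ insert e S := by ext; simp; tauto
      rw [h4]
    · rw [if_neg h]
      split_ifs
      · exact hg0 _
      · exact le_rfl
      · exact le_rfl

end Bernoulli

/-! ### Percolation connectivity -/

section Percolation

open Classical

variable {V : Type*} [Fintype V] {G : SimpleGraph V} {p : ℝ}

theorem percExp_eq_bernoulliExp (G : SimpleGraph V) (p : ℝ) (f : Finset (Sym2 V) → ℝ) :
    percExp G p f = bernoulliExp G.edgeFinset p f := rfl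

theorem percProb_mono (hp : p ∈ Set.Icc (0 : ℝ) 1) {A B : Finset (Sym2 V) → Prop}
    (h : ∀ ω ⊆ G.edgeFinset, A ω → B ω) : percProb G p A ≤ percProb G p B := by
  refine bernoulliExp_mono hp fun ω hω => ?_
  split_ifs with ha hb
  · exact le_rfl
  · exact absurd (h ω hω ha) hb
  · exact zero_le_one
  · exact le_rfl

theorem percProb_nonneg (hp : p ∈ Set.Icc (0 : ℝ) 1) (A : Finset (Sym2 V) → Prop) :
    0 ≤ percProb G p A := by
  refine (bernoulliExp_zero G.edgeFinset p).symm.trans_le (bernoulliExp_mono hp fun ω _ => ?_)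
  split_ifs <;> norm_num

theorem percProb_le_sum (hp : p ∈ Set.Icc (0 : ℝ) 1) {ι : Type*} (s : Finset ι)
    {A : Finset (Sym2 V) → Prop} {B : ι → Finset (Sym2 V) → Prop}
    (h : ∀ ω ⊆ G.edgeFinset, A ω → ∃ i ∈ s, B i ω) :
    percProb G p A ≤ ∑ i ∈ s, percProb G p (B i) := by
  unfold percProb
  simp_rw [percExp_eq_bernoulliExp]
  rw [← bernoulliExp_sum]
  refine bernoulliExp_mono hp fun ω hω => ?_
  have h0 : ∀ i ∈ s, (0 : ℝ) ≤ if B i ω then 1 else 0 := fun i _ => by split_ifs <;> norm_num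
  split_ifs with ha
  · obtain ⟨i, hi, hb⟩ := h ω hω ha
    calc (1 : ℝ) = if B i ω then 1 else 0 := by rw [if_pos hb]
      _ ≤ _ := Finset.single_le_sum h0 hi
  · exact Finset.sum_nonneg h0

/-- This plays the part of the BK inequality: one of the two disjoint witnesses is a fixed edge set,
so independence suffices. -/
theorem percProb_subset_sdiff_le (hp : p ∈ Set.Icc (0 : ℝ) 1) {A : Finset (Sym2 V) → Prop}
    (hA : ∀ ω ω', ω ⊆ ω' → A ω → A ω') {S : Finset (Sym2 V)} (hS : S ⊆ G.edgeFinset) :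
    percProb G p (fun ω => S ⊆ ω ∧ A (ω \ S)) ≤ p ^ S.card * percProb G p A := by
  have h := bernoulliExp_subset_sdiff_le hp (g := fun ω => if A ω then (1 : ℝ) else 0)
    (fun a b hab => by
      dsimp only
      split_ifs with ha hb
      · exact le_rfl
      · exact absurd (hA a b hab ha) hb
      · exact zero_le_one
      · exact le_rfl) (fun ω => by split_ifs <;> norm_num) hS
  refine le_of_eq_of_le ?_ h
  unfold percProb
  rw [percExp_eq_bernoulliExp]
  congr 1
  ext ω
  by_cases h1 : S ⊆ ω <;> simp [h1]

theorem percProb_true (G : SimpleGraph V) (p : ℝ) : percProb G p (fun _ => True) = 1 := by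
  simpa [percProb, percExp_eq_bernoulliExp] using bernoulliExp_one G.edgeFinset p

/-- The two-point function `𝐏_p(x ↔ y)`. -/
noncomputable def twoPoint (G : SimpleGraph V) (p : ℝ) (x y : V) : ℝ :=
  percProb G p (fun ω => Connects ω x y)

omit [Fintype V] in
theorem Connects.mono {ω ω' : Finset (Sym2 V)} (h : ω ⊆ ω') {x y : V} (hc : Connects ω x y) :
    Connects ω' x y :=
  SimpleGraph.Reachable.mono (SimpleGraph.fromEdgeSet_mono (Finset.coe_subset.2 h)) hc

theorem twoPoint_comm (G : SimpleGraph V) (p : ℝ) (x y : V) :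
    twoPoint G p x y = twoPoint G p y x := by
  unfold twoPoint
  congr 1
  ext ω
  exact ⟨SimpleGraph.Reachable.symm, SimpleGraph.Reachable.symm⟩

theorem sum_twoPoint (G : SimpleGraph V) (p : ℝ) (x : V) :
    ∑ y, twoPoint G p x y = chi G x p := by
  unfold twoPoint percProb chi
  simp_rw [percExp_eq_bernoulliExp]
  rw [← bernoulliExp_sum]
  congr 1
  ext ω
  rw [Finset.sum_boole, Set.ncard_eq_toFinset_card']
  congr 2
  ext y
  rw [Finset.mem_filter_univ, Set.mem_toFinset]
  rfl

omit [Fintype V] in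
theorem connects_image_iff (φ : V ≃ V) (ω : Finset (Sym2 V)) (x y : V) :
    Connects (ω.image (Sym2.map φ)) (φ x) (φ y) ↔ Connects ω x y := by
  let ψ : SimpleGraph.fromEdgeSet (ω : Set (Sym2 V)) ≃g
      SimpleGraph.fromEdgeSet ((ω.image (Sym2.map φ) : Finset (Sym2 V)) : Set (Sym2 V)) :=
    { toEquiv := φ
      map_rel_iff' := by
        intro a b
        have : s(φ a, φ b) = Sym2.map φ s(a, b) := rfl
        simp only [SimpleGraph.fromEdgeSet_adj, Finset.mem_coe, this,
          (Sym2.map.injective φ.injective).mem_finset_image, φ.injective.ne_iff] }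
  exact ψ.reachable_iff

theorem twoPoint_iso (φ : G ≃g G) (p : ℝ) (x y : V) :
    twoPoint G p (φ x) (φ y) = twoPoint G p x y := by
  have hinj : Function.Injective (Sym2.map φ) := Sym2.map.injective φ.injective
  have hE : G.edgeFinset.image (Sym2.map φ) = G.edgeFinset := by
    refine Finset.eq_of_subset_of_card_le ?_ (Finset.card_image_of_injective _ hinj).ge
    intro e he
    obtain ⟨e, he', rfl⟩ := Finset.mem_image.1 he
    clear he
    induction e with
    | _ a b =>
      rw [SimpleGraph.mem_edgeFinset, SimpleGraph.mem_edgeSet] at he'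
      rw [Sym2.map_mk, SimpleGraph.mem_edgeFinset, SimpleGraph.mem_edgeSet]
      exact φ.map_adj_iff.2 he'
  symm
  unfold twoPoint percProb percExp
  refine Finset.sum_bij' (fun ω _ => ω.image (Sym2.map φ)) (fun ω _ => ω.image (Sym2.map φ.symm))
    ?_ ?_ ?_ ?_ ?_
  · intro ω hω
    rw [Finset.mem_powerset] at hω ⊢
    rw [← hE]
    exact Finset.image_subset_image hω
  · intro ω hω
    rw [Finset.mem_powerset] at hω ⊢
    intro e he
    obtain ⟨e, he', rfl⟩ := Finset.mem_image.1 he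
    have he := hω he'
    induction e with
    | _ a b =>
      rw [SimpleGraph.mem_edgeFinset, SimpleGraph.mem_edgeSet] at he
      rw [Sym2.map_mk, SimpleGraph.mem_edgeFinset, SimpleGraph.mem_edgeSet]
      exact φ.symm.map_adj_iff.2 he
  · intro ω _
    simp [Finset.image_image, Function.comp_def, Sym2.map_map]
  · intro ω _
    simp [Finset.image_image, Function.comp_def, Sym2.map_map]
  · intro ω hω
    have h1 : G.edgeFinset \ ω.image (Sym2.map φ) = (G.edgeFinset \ ω).image (Sym2.map φ) := by
      rw [Finset.image_sdiff _ _ hinj, hE]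
    rw [h1, Finset.card_image_of_injective _ hinj, Finset.card_image_of_injective _ hinj]
    congr 1
    have := connects_image_iff φ.toEquiv ω x y
    simp only [RelIso.coe_fn_toEquiv] at this
    simp only [this]

theorem chi_eq_of_isTransitive (hG : IsTransitive G) (p : ℝ) (x o : V) :
    chi G x p = chi G o p := by
  obtain ⟨φ, rfl⟩ := hG o x
  rw [← sum_twoPoint, ← sum_twoPoint, ← Equiv.sum_comp φ.toEquiv]
  exact Finset.sum_congr rfl fun y _ => twoPoint_iso φ p o y

end Percolation

/-! ### Open paths and their comparison with non-backtracking walks. -/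

section Paths

open Classical

variable {V : Type*} [Fintype V] {G : SimpleGraph V} {p : ℝ}

/-- The paths (self-avoiding walks) of length `k` from `x` to `y` in `G`. -/
noncomputable def pathsOfLength (G : SimpleGraph V) (k : ℕ) (x y : V) : Finset (G.Walk x y) :=
  (G.finsetWalkLength k x y).filter fun γ => γ.IsPath

theorem mem_pathsOfLength {k : ℕ} {x y : V} {γ : G.Walk x y} :
    γ ∈ pathsOfLength G k x y ↔ γ.length = k ∧ γ.IsPath := by
  rw [pathsOfLength, Finset.mem_filter, SimpleGraph.mem_finsetWalkLength_iff]

theorem card_edges_of_mem_pathsOfLength {k : ℕ} {x y : V} {γ : G.Walk x y}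
    (h : γ ∈ pathsOfLength G k x y) : γ.edges.toFinset.card = k := by
  obtain ⟨h1, h2⟩ := mem_pathsOfLength.1 h
  rw [List.toFinset_card_of_nodup h2.isTrail.edges_nodup, SimpleGraph.Walk.length_edges, h1]

omit [Fintype V] in
theorem edges_subset_of_fromEdgeSet {ω : Finset (Sym2 V)} {x y : V}
    (γ : (SimpleGraph.fromEdgeSet (ω : Set (Sym2 V))).Walk x y) {e : Sym2 V} (he : e ∈ γ.edges) :
    e ∈ ω := by
  have := γ.edges_subset_edgeSet he
  rw [SimpleGraph.edgeSet_fromEdgeSet] at this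
  exact this.1

theorem edges_toFinset_subset {x y : V} (γ : G.Walk x y) : γ.edges.toFinset ⊆ G.edgeFinset := by
  intro e he
  rw [SimpleGraph.mem_edgeFinset]
  exact γ.edges_subset_edgeSet (List.mem_toFinset.1 he)

/-- There is an open path of length at least `k` from `x` to `y`. -/
def LongPath (ω : Finset (Sym2 V)) (k : ℕ) (x y : V) : Prop :=
  ∃ γ : (SimpleGraph.fromEdgeSet (ω : Set (Sym2 V))).Walk x y, γ.IsPath ∧ k ≤ γ.length

/-- There is an open path of length at most `k` from `x` to `y`. -/
def ShortPath (ω : Finset (Sym2 V)) (k : ℕ) (x y : V) : Prop :=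
  ∃ γ : (SimpleGraph.fromEdgeSet (ω : Set (Sym2 V))).Walk x y, γ.IsPath ∧ γ.length ≤ k

omit [Fintype V] in
theorem ShortPath.connects {ω : Finset (Sym2 V)} {k : ℕ} {x y : V} (h : ShortPath ω k x y) :
    Connects ω x y := h.choose.reachable

omit [Fintype V] in
theorem Connects.shortPath_or_longPath {ω : Finset (Sym2 V)} {x y : V} (h : Connects ω x y)
    (k : ℕ) : ShortPath ω k x y ∨ LongPath ω (k + 1) x y := by
  obtain ⟨γ, hγ⟩ := SimpleGraph.Reachable.exists_isPath h
  rcases le_or_gt γ.length k with hk | hk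
  · exact Or.inl ⟨γ, hγ, hk⟩
  · exact Or.inr ⟨γ, hγ, hk⟩

/-- Union bound over the paths of `G`: one with `k` edges is open with probability `p ^ k`. -/
theorem percProb_shortPath_le (hp : p ∈ Set.Icc (0 : ℝ) 1) (T : ℕ) (x y : V) :
    percProb G p (fun ω => ShortPath ω T x y) ≤
      ∑ k ∈ Finset.range (T + 1), p ^ k * ((pathsOfLength G k x y).card : ℝ) := by
  have h1 : percProb G p (fun ω => ShortPath ω T x y) ≤
      ∑ i ∈ (Finset.range (T + 1)).sigma (fun k => pathsOfLength G k x y),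
        percProb G p (fun ω => i.2.edges.toFinset ⊆ ω ∧ True) := by
    refine percProb_le_sum hp _ fun ω hω h => ?_
    obtain ⟨γ, hγ, hl⟩ := h
    have hG : ∀ e ∈ γ.edges, e ∈ G.edgeSet := fun e he =>
      SimpleGraph.mem_edgeFinset.1 (hω (edges_subset_of_fromEdgeSet γ he))
    refine ⟨⟨γ.length, γ.transfer G hG⟩, ?_, ?_, trivial⟩
    · rw [Finset.mem_sigma, Finset.mem_range, mem_pathsOfLength]
      exact ⟨Nat.lt_succ_of_le hl, γ.length_transfer hG, hγ.transfer hG⟩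
    · intro e he
      rw [List.mem_toFinset, SimpleGraph.Walk.edges_transfer] at he
      exact edges_subset_of_fromEdgeSet γ he
  refine h1.trans ?_
  rw [Finset.sum_sigma]
  refine Finset.sum_le_sum fun k _ => ?_
  rw [mul_comm, ← nsmul_eq_mul, ← Finset.sum_const]
  refine Finset.sum_le_sum fun γ hγ => ?_
  refine (percProb_subset_sdiff_le hp (A := fun _ => True) (fun _ _ _ _ => trivial)
    (edges_toFinset_subset γ)).trans_eq ?_
  rw [card_edges_of_mem_pathsOfLength hγ, percProb_true, mul_one]

/-- Cutting off the last `k` steps of a long open path: these steps are open, and the rest of the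
path is a connection off them. -/
theorem percProb_longPath_le (hp : p ∈ Set.Icc (0 : ℝ) 1) (k : ℕ) (x y : V) :
    percProb G p (fun ω => LongPath ω k x y) ≤
      ∑ z, twoPoint G p x z * (p ^ k * ((pathsOfLength G k z y).card : ℝ)) := by
  have h1 : percProb G p (fun ω => LongPath ω k x y) ≤
      ∑ i ∈ (Finset.univ : Finset V).sigma (fun z => pathsOfLength G k z y),
        percProb G p (fun ω => i.2.edges.toFinset ⊆ ω ∧
          Connects (ω \ i.2.edges.toFinset) x i.1) := by
    refine percProb_le_sum hp _ fun ω hω h => ?_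
    obtain ⟨γ, hγ, hl⟩ := h
    -- The cut point, chosen so that exactly `k` steps remain.
    set n := γ.length - k with hn
    have hG : ∀ e ∈ (γ.drop n).edges, e ∈ G.edgeSet := fun e he =>
      SimpleGraph.mem_edgeFinset.1 (hω (edges_subset_of_fromEdgeSet _ he))
    refine ⟨⟨γ.getVert n, (γ.drop n).transfer G hG⟩, ?_, ?_, ?_⟩
    · rw [Finset.mem_sigma, mem_pathsOfLength]
      refine ⟨Finset.mem_univ _, ?_, (hγ.drop n).transfer hG⟩
      rw [SimpleGraph.Walk.length_transfer, SimpleGraph.Walk.drop_length]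
      omega
    · intro e he
      rw [List.mem_toFinset, SimpleGraph.Walk.edges_transfer] at he
      exact edges_subset_of_fromEdgeSet _ he
    -- A path repeats no edge, so its head survives the removal of the edges of its tail.
    · have hd : List.Disjoint (γ.take n).edges (γ.drop n).edges := by
        rw [SimpleGraph.Walk.edges_take, SimpleGraph.Walk.edges_drop]
        exact List.disjoint_take_drop hγ.isTrail.edges_nodup le_rfl
      refine ((γ.take n).transfer _ fun e he => ?_).reachable
      rw [SimpleGraph.edgeSet_fromEdgeSet]
      refine ⟨?_, SimpleGraph.not_isDiag_of_mem_edgeSet _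
        ((γ.take n).edges_subset_edgeSet he)⟩
      rw [Finset.mem_coe, Finset.mem_sdiff, List.mem_toFinset, SimpleGraph.Walk.edges_transfer]
      exact ⟨edges_subset_of_fromEdgeSet _ he, hd he⟩
  refine h1.trans ?_
  rw [Finset.sum_sigma]
  refine Finset.sum_le_sum fun z _ => ?_
  have h2 : ∀ γ ∈ pathsOfLength G k z y, percProb G p (fun ω => γ.edges.toFinset ⊆ ω ∧
      Connects (ω \ γ.edges.toFinset) x z) ≤ p ^ k * twoPoint G p x z := fun γ hγ => by
    refine (percProb_subset_sdiff_le hp (A := fun ω => Connects ω x z)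
      (fun _ _ h hc => hc.mono h) (edges_toFinset_subset γ)).trans_eq ?_
    rw [card_edges_of_mem_pathsOfLength hγ]
    rfl
  refine (Finset.sum_le_card_nsmul _ _ _ h2).trans_eq ?_
  rw [nsmul_eq_mul]
  ring

/-! ### Non-backtracking walks -/

theorem nbwFrom_nonneg (t : ℕ) (w x y : V) : 0 ≤ nbwFrom G t w x y := by
  induction t generalizing w x with
  | zero => rw [nbwFrom]; split_ifs <;> norm_num
  | succ t ih => exact Finset.sum_nonneg fun z _ => mul_nonneg (by positivity) (ih _ _)

theorem nbw_nonneg (t : ℕ) (x y : V) : 0 ≤ nbw G t x y := by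
  cases t with
  | zero => rw [nbw]; split_ifs <;> norm_num
  | succ t =>
    exact Finset.sum_nonneg fun z _ => mul_nonneg (by positivity) (nbwFrom_nonneg _ _ _ _)

/-- An average over a finite set is at most any bound of its terms. -/
theorem sum_one_div_card_mul_le {ι : Type*} (s : Finset ι) (f : ι → ℝ) {c : ℝ} (hc : 0 ≤ c)
    (h : ∀ i ∈ s, f i ≤ c) : ∑ i ∈ s, (1 / (s.card : ℝ)) * f i ≤ c := by
  rcases s.eq_empty_or_nonempty with rfl | hs
  · simpa using hc
  · have h0 : (0 : ℝ) < s.card := by exact_mod_cast hs.card_pos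
    rw [← Finset.mul_sum, one_div, inv_mul_le_iff₀ h0, ← nsmul_eq_mul]
    exact Finset.sum_le_card_nsmul _ _ _ h

/-- Only an inequality: where no step is admissible the sum over steps is empty and mass is lost. -/
theorem sum_nbwFrom_le_one (t : ℕ) (w x : V) : ∑ y, nbwFrom G t w x y ≤ 1 := by
  induction t generalizing w x with
  | zero => simp [nbwFrom]
  | succ t ih =>
    simp_rw [nbwFrom]
    rw [Finset.sum_comm]
    simp_rw [← Finset.mul_sum]
    rw [Finset.mul_sum]
    exact sum_one_div_card_mul_le _ _ zero_le_one fun z _ => ih _ _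

theorem sum_nbw_le_one (t : ℕ) (x : V) : ∑ y, nbw G t x y ≤ 1 := by
  cases t with
  | zero => simp [nbw]
  | succ t =>
    simp_rw [nbw]
    rw [Finset.sum_comm]
    simp_rw [← Finset.mul_sum]
    rw [Finset.mul_sum]
    exact sum_one_div_card_mul_le _ _ zero_le_one fun z _ => sum_nbwFrom_le_one _ _ _

theorem HasDegree.card_neighborFinset {m : ℕ} (hG : HasDegree G m) (x : V) :
    (G.neighborFinset x).card = m := hG x

theorem HasDegree.card_neighborFinset_erase {m : ℕ} (hG : HasDegree G m) {w x : V}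
    (h : G.Adj w x) : ((G.neighborFinset x).erase w).card = m - 1 := by
  rw [Finset.card_erase_of_mem (by simpa using h.symm), hG.card_neighborFinset]

/-- The last step is uniform over `m - 1` vertices whatever the past; earlier steps only average
this bound. -/
theorem nbwFrom_succ_le {m : ℕ} (hG : HasDegree G m) (hm : 2 ≤ m) (t : ℕ) {w x : V}
    (h : G.Adj w x) (y : V) : nbwFrom G (t + 1) w x y ≤ 1 / ((m : ℝ) - 1) := by
  have hm' : (2 : ℝ) ≤ m := by exact_mod_cast hm
  have h0 : 0 ≤ 1 / ((m : ℝ) - 1) := one_div_nonneg.2 (by linarith)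
  induction t generalizing w x with
  | zero =>
    simp only [nbwFrom, hG.card_neighborFinset_erase h, mul_ite, mul_one, mul_zero,
      Finset.sum_ite_eq']
    rw [Nat.cast_sub (by omega), Nat.cast_one]
    split_ifs
    · exact le_rfl
    · exact h0
  | succ t ih =>
    rw [nbwFrom]
    refine sum_one_div_card_mul_le _ _ h0 fun z hz => ih ?_
    simpa using Finset.mem_of_mem_erase hz

theorem nbw_succ_le {m : ℕ} (hG : HasDegree G m) (hm : 2 ≤ m) (t : ℕ) (x y : V) :
    nbw G (t + 1) x y ≤ 1 / ((m : ℝ) - 1) := by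
  have hm' : (2 : ℝ) ≤ m := by exact_mod_cast hm
  have h0 : 0 ≤ 1 / ((m : ℝ) - 1) := one_div_nonneg.2 (by linarith)
  cases t with
  | zero =>
    simp only [nbw, nbwFrom, hG.card_neighborFinset, mul_ite, mul_one, mul_zero,
      Finset.sum_ite_eq']
    split_ifs
    · exact one_div_le_one_div_of_le (by linarith) (by linarith)
    · exact h0
  | succ t =>
    rw [nbw]
    refine sum_one_div_card_mul_le _ _ h0 fun z hz => nbwFrom_succ_le hG hm t ?_ y
    simpa using hz

theorem card_pathsOfLength_zero_le (x y : V) :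
    ((pathsOfLength G 0 x y).card : ℝ) ≤ nbw G 0 x y := by
  rw [nbw]
  by_cases hxy : x = y
  · subst hxy
    rw [if_pos rfl]
    have : (G.finsetWalkLength 0 x x).card ≤ 1 := by simp [SimpleGraph.finsetWalkLength]
    exact_mod_cast (Finset.card_filter_le _ _).trans this
  · rw [if_neg hxy]
    have : pathsOfLength G 0 x y = ∅ := by simp [pathsOfLength, SimpleGraph.finsetWalkLength, hxy]
    simp [this]

/-- Each non-backtracking trajectory has probability `(m - 1)^(-t)`, and paths are among them.
Avoiding `w` altogether is stronger than not stepping back to it, but it is what passes to the tail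
of a path. -/
theorem card_filter_avoiding_le {m : ℕ} (hG : HasDegree G m) (hm : 2 ≤ m) (t : ℕ) {w x : V}
    (h : G.Adj w x) (y : V) :
    (((pathsOfLength G t x y).filter fun γ => w ∉ γ.support).card : ℝ) ≤
      ((m : ℝ) - 1) ^ t * nbwFrom G t w x y := by
  have hm' : (2 : ℝ) ≤ m := by exact_mod_cast hm
  induction t generalizing w x with
  | zero =>
    rw [pow_zero, one_mul]
    exact (Nat.cast_le.2 (Finset.card_filter_le _ _)).trans (card_pathsOfLength_zero_le x y)
  | succ t ih =>
    have hsub : ((pathsOfLength G (t + 1) x y).filter fun γ => w ∉ γ.support) ⊆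
        ((G.neighborFinset x).erase w).attach.biUnion fun z =>
          ((pathsOfLength G t z.1 y).filter fun γ => x ∉ γ.support).image
            (SimpleGraph.Walk.cons ((G.mem_neighborFinset x z.1).1 (Finset.mem_of_mem_erase z.2))) := by
      intro γ hγ
      rw [Finset.mem_filter, mem_pathsOfLength] at hγ
      obtain ⟨⟨hl, hpath⟩, hw⟩ := hγ
      cases γ with
      | nil => simp at hl
      | @cons _ z _ hxz γ =>
        rw [SimpleGraph.Walk.cons_isPath_iff] at hpath
        have hz : z ∈ (G.neighborFinset x).erase w := by
          rw [Finset.mem_erase, SimpleGraph.mem_neighborFinset]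
          refine ⟨fun hzw => hw ?_, hxz⟩
          subst hzw
          simp
        rw [Finset.mem_biUnion]
        refine ⟨⟨z, hz⟩, Finset.mem_attach _ _, Finset.mem_image.2 ⟨γ, ?_, rfl⟩⟩
        rw [Finset.mem_filter, mem_pathsOfLength]
        exact ⟨⟨by simpa using hl, hpath.1⟩, hpath.2⟩
    have h1 : (((pathsOfLength G (t + 1) x y).filter fun γ => w ∉ γ.support).card : ℝ) ≤
        ∑ z ∈ ((G.neighborFinset x).erase w).attach,
          (((pathsOfLength G t z.1 y).filter fun γ => x ∉ γ.support).card : ℝ) := by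
      refine (Nat.cast_le.2 ((Finset.card_le_card hsub).trans Finset.card_biUnion_le)).trans ?_
      rw [Nat.cast_sum]
      exact Finset.sum_le_sum fun z _ => Nat.cast_le.2 Finset.card_image_le
    refine h1.trans ?_
    rw [Finset.sum_attach _ fun z =>
      (((pathsOfLength G t z y).filter fun γ => x ∉ γ.support).card : ℝ), nbwFrom, Finset.mul_sum]
    refine Finset.sum_le_sum fun z hz => ?_
    have hxz : G.Adj x z := by simpa using Finset.mem_of_mem_erase hz
    rw [hG.card_neighborFinset_erase h, Nat.cast_sub (by omega), Nat.cast_one]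
    refine (ih hxz).trans_eq ?_
    have : (m : ℝ) - 1 ≠ 0 := by linarith
    field_simp
    ring

theorem card_pathsOfLength_succ_le {m : ℕ} (hG : HasDegree G m) (hm : 2 ≤ m) (t : ℕ) (x y : V) :
    ((pathsOfLength G (t + 1) x y).card : ℝ) ≤
      m * ((m : ℝ) - 1) ^ t * nbw G (t + 1) x y := by
  have hm' : (2 : ℝ) ≤ m := by exact_mod_cast hm
  have hsub : pathsOfLength G (t + 1) x y ⊆
      (G.neighborFinset x).attach.biUnion fun z =>
        ((pathsOfLength G t z.1 y).filter fun γ => x ∉ γ.support).image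
          (SimpleGraph.Walk.cons ((G.mem_neighborFinset x z.1).1 z.2)) := by
    intro γ hγ
    obtain ⟨hl, hpath⟩ := mem_pathsOfLength.1 hγ
    cases γ with
    | nil => simp at hl
    | @cons _ z _ hxz γ =>
      rw [SimpleGraph.Walk.cons_isPath_iff] at hpath
      rw [Finset.mem_biUnion]
      refine ⟨⟨z, by simpa using hxz⟩, Finset.mem_attach _ _, Finset.mem_image.2 ⟨γ, ?_, rfl⟩⟩
      rw [Finset.mem_filter, mem_pathsOfLength]
      exact ⟨⟨by simpa using hl, hpath.1⟩, hpath.2⟩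
  have h1 : ((pathsOfLength G (t + 1) x y).card : ℝ) ≤
      ∑ z ∈ (G.neighborFinset x).attach,
        (((pathsOfLength G t z.1 y).filter fun γ => x ∉ γ.support).card : ℝ) := by
    refine (Nat.cast_le.2 ((Finset.card_le_card hsub).trans Finset.card_biUnion_le)).trans ?_
    rw [Nat.cast_sum]
    exact Finset.sum_le_sum fun z _ => Nat.cast_le.2 Finset.card_image_le
  refine h1.trans ?_
  rw [Finset.sum_attach _ fun z =>
    (((pathsOfLength G t z y).filter fun γ => x ∉ γ.support).card : ℝ), nbw, Finset.mul_sum]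
  refine Finset.sum_le_sum fun z hz => ?_
  rw [hG.card_neighborFinset]
  refine (card_filter_avoiding_le hG hm t (by simpa using hz) y).trans_eq ?_
  have : (m : ℝ) ≠ 0 := by linarith
  field_simp

end Paths

/-! ### The triangle diagram: short paths, long paths and mixing. -/

section Triangle

open Classical

variable {V : Type*} [Fintype V] {G : SimpleGraph V} {p : ℝ}

/-- The first step has `m` choices and the others `m - 1`; the factor 2 comes from `m ≤ 2(m - 1)`.
-/
theorem pow_mul_card_pathsOfLength_le {m : ℕ} (hG : HasDegree G m) (hm : 2 ≤ m) (hp : 0 ≤ p)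
    {K : ℝ} {t : ℕ} (ht : t ≠ 0) (hK : (p * ((m : ℝ) - 1)) ^ t ≤ K) (x y : V) :
    p ^ t * ((pathsOfLength G t x y).card : ℝ) ≤ 2 * K * nbw G t x y := by
  have hm' : (2 : ℝ) ≤ m := by exact_mod_cast hm
  obtain ⟨s, rfl⟩ := Nat.exists_eq_succ_of_ne_zero ht
  have h0 : 0 ≤ ((m : ℝ) - 1) ^ s := pow_nonneg (by linarith) s
  calc p ^ (s + 1) * ((pathsOfLength G (s + 1) x y).card : ℝ)
      ≤ p ^ (s + 1) * (m * ((m : ℝ) - 1) ^ s * nbw G (s + 1) x y) :=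
        mul_le_mul_of_nonneg_left (card_pathsOfLength_succ_le hG hm s x y) (pow_nonneg hp _)
    _ ≤ p ^ (s + 1) * (2 * ((m : ℝ) - 1) * ((m : ℝ) - 1) ^ s * nbw G (s + 1) x y) := by
        have := nbw_nonneg (G := G) (s + 1) x y
        gcongr
        linarith
    _ = 2 * (p * ((m : ℝ) - 1)) ^ (s + 1) * nbw G (s + 1) x y := by
        rw [mul_pow]
        ring
    _ ≤ 2 * K * nbw G (s + 1) x y := by
        have := nbw_nonneg (G := G) (s + 1) x y
        gcongr

/-- Time zero keeps the constant 1, so that the indicator in the final bound has coefficient exactly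
1. -/
theorem percProb_shortPath_le_sum_nbw {m : ℕ} (hG : HasDegree G m) (hm : 2 ≤ m)
    (hp : p ∈ Set.Icc (0 : ℝ) 1) {T : ℕ} (hq : ∀ t ≤ T, (p * ((m : ℝ) - 1)) ^ t ≤ 2) (x y : V) :
    percProb G p (fun ω => ShortPath ω T x y) ≤
      ∑ t ∈ Finset.range (T + 1), (if t = 0 then 1 else 4) * nbw G t x y := by
  refine (percProb_shortPath_le hp T x y).trans (Finset.sum_le_sum fun t ht => ?_)
  split_ifs with h
  · subst h
    rw [pow_zero, one_mul, one_mul]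
    exact card_pathsOfLength_zero_le x y
  · refine (pow_mul_card_pathsOfLength_le hG hm hp.1 h
      (hq t (Nat.lt_succ_iff.1 (Finset.mem_range.1 ht))) x y).trans_eq ?_
    norm_num

theorem twoPoint_nonneg (hp : p ∈ Set.Icc (0 : ℝ) 1) (x y : V) : 0 ≤ twoPoint G p x y :=
  percProb_nonneg hp _

/-- Long connections are as likely as connections between vertices in equilibrium. -/
theorem percProb_longPath_le_chi_div_card {m : ℕ} (hG : HasDegree G m) (hm : 2 ≤ m)
    (hp : p ∈ Set.Icc (0 : ℝ) 1) {T : ℕ} (hT : 1 ≤ T)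
    (hq : ∀ t ≤ T, (p * ((m : ℝ) - 1)) ^ t ≤ 2) {δ : ℝ} (hδ : δ ≤ 1)
    (hmix : IsMixingTime G δ T) (x y : V) :
    percProb G p (fun ω => LongPath ω (T + 1) x y) ≤
      16 * chi G x p / (Fintype.card V : ℝ) := by
  have hm' : (2 : ℝ) ≤ m := by exact_mod_cast hm
  have hq0 : 0 ≤ p * ((m : ℝ) - 1) := mul_nonneg hp.1 (by linarith)
  -- Mixing controls only the mean of two consecutive times, so the path is cut both `T` and `T + 1`
  -- steps from its end, with the common constant `8 = 2 * 4`, and the two bounds are averaged.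
  have h1 : percProb G p (fun ω => LongPath ω (T + 1) x y) ≤
      ∑ z, twoPoint G p x z * (8 * nbw G T z y) := by
    refine (percProb_mono hp fun ω _ h => ?_).trans ((percProb_longPath_le hp T x y).trans
      (Finset.sum_le_sum fun z _ => mul_le_mul_of_nonneg_left ?_ (twoPoint_nonneg hp x z)))
    · obtain ⟨γ, hγ, hl⟩ := h
      exact ⟨γ, hγ, by omega⟩
    · exact (pow_mul_card_pathsOfLength_le hG hm hp.1 (by omega)
        ((hq T le_rfl).trans (by norm_num : (2 : ℝ) ≤ 4)) z y).trans_eq (by norm_num)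
  have h2 : percProb G p (fun ω => LongPath ω (T + 1) x y) ≤
      ∑ z, twoPoint G p x z * (8 * nbw G (T + 1) z y) := by
    refine (percProb_longPath_le hp (T + 1) x y).trans
      (Finset.sum_le_sum fun z _ => mul_le_mul_of_nonneg_left ?_ (twoPoint_nonneg hp x z))
    refine (pow_mul_card_pathsOfLength_le hG hm hp.1 (by omega) (K := 4) ?_ z y).trans_eq
      (by norm_num)
    have h1 := hq 1 hT
    have h2 := hq T le_rfl
    rw [pow_one] at h1
    rw [pow_succ]
    nlinarith [pow_nonneg hq0 T]
  have h3 : ∀ z, (nbw G T z y + nbw G (T + 1) z y) / 2 ≤ 2 * (Fintype.card V : ℝ)⁻¹ :=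
    fun z => (hmix.1 z y).trans
      (mul_le_mul_of_nonneg_right (by linarith) (by positivity))
  calc percProb G p (fun ω => LongPath ω (T + 1) x y)
      ≤ (∑ z, twoPoint G p x z * (8 * nbw G T z y) +
          ∑ z, twoPoint G p x z * (8 * nbw G (T + 1) z y)) / 2 := by linarith
    _ = ∑ z, twoPoint G p x z * (8 * ((nbw G T z y + nbw G (T + 1) z y) / 2)) := by
        rw [← Finset.sum_add_distrib, Finset.sum_div]
        exact Finset.sum_congr rfl fun z _ => by ring
    _ ≤ ∑ z, twoPoint G p x z * (8 * (2 * (Fintype.card V : ℝ)⁻¹)) :=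
        Finset.sum_le_sum fun z _ => mul_le_mul_of_nonneg_left
          (mul_le_mul_of_nonneg_left (h3 z) (by norm_num)) (twoPoint_nonneg hp x z)
    _ = _ := by
        rw [← Finset.sum_mul, sum_twoPoint]
        ring

/-- The convolution `∑_{u,v} 𝐩^{t₁}(x,u) 𝐩^{t₂}(u,v) 𝐩^{t₃}(v,y)`. -/
noncomputable def nbwConv (G : SimpleGraph V) (t : ℕ × ℕ × ℕ) (x y : V) : ℝ :=
  ∑ u : V, ∑ v : V, nbw G t.1 x u * nbw G t.2.1 u v * nbw G t.2.2 v y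

theorem nbwConv_nonneg (t : ℕ × ℕ × ℕ) (x y : V) : 0 ≤ nbwConv G t x y :=
  Finset.sum_nonneg fun _ _ => Finset.sum_nonneg fun _ _ =>
    mul_nonneg (mul_nonneg (nbw_nonneg _ _ _) (nbw_nonneg _ _ _)) (nbw_nonneg _ _ _)

theorem nbwTriple_eq_sum_nbwConv (T : ℕ) (x y : V) :
    nbwTriple G T x y =
      ∑ t ∈ (Finset.range (T + 1) ×ˢ Finset.range (T + 1) ×ˢ Finset.range (T + 1)).filter
        (fun t => 3 ≤ t.1 + t.2.1 + t.2.2), nbwConv G t x y := by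
  unfold nbwTriple nbwConv
  rw [Finset.sum_congr rfl fun u _ => Finset.sum_comm, Finset.sum_comm]

theorem nbwConv_zero (x y : V) : nbwConv G (0, 0, 0) x y = if x = y then 1 else 0 := by
  simp [nbwConv, nbw]

/-- Averaging a bounded function over the walk does not increase its bound. -/
theorem sum_nbw_mul_le (t : ℕ) (x : V) {f : V → ℝ} {K : ℝ} (hK : 0 ≤ K) (hf : ∀ y, f y ≤ K) :
    ∑ y, nbw G t x y * f y ≤ K :=
  calc ∑ y, nbw G t x y * f y ≤ ∑ y, nbw G t x y * K :=
        Finset.sum_le_sum fun y _ => mul_le_mul_of_nonneg_left (hf y) (nbw_nonneg _ _ _)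
    _ = (∑ y, nbw G t x y) * K := (Finset.sum_mul _ _ _).symm
    _ ≤ K := mul_le_of_le_one_left hK (sum_nbw_le_one t x)

/-- Some time is positive. The last such factor is at most `1/(m - 1)`, the factors before it
average this bound, and those after it are the identity. -/
theorem nbwConv_le {m : ℕ} (hG : HasDegree G m) (hm : 2 ≤ m) {t : ℕ × ℕ × ℕ}
    (ht : t ≠ (0, 0, 0)) (x y : V) : nbwConv G t x y ≤ 1 / ((m : ℝ) - 1) := by
  have hm' : (2 : ℝ) ≤ m := by exact_mod_cast hm
  have h0 : 0 ≤ 1 / ((m : ℝ) - 1) := one_div_nonneg.2 (by linarith)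
  have hone : ∀ t, t ≠ 0 → ∀ u v, nbw G t u v ≤ 1 / ((m : ℝ) - 1) := fun t ht u v => by
    obtain ⟨s, rfl⟩ := Nat.exists_eq_succ_of_ne_zero ht
    exact nbw_succ_le hG hm s u v
  obtain ⟨a, b, c⟩ := t
  simp_rw [nbwConv, mul_assoc, ← Finset.mul_sum]
  by_cases hc : c = 0
  · by_cases hb : b = 0
    · subst hc hb
      have ha : a ≠ 0 := fun ha => ht (by rw [ha])
      simpa [nbw] using hone a ha x y
    · refine sum_nbw_mul_le a x h0 fun u => ?_
      subst hc
      simpa [nbw] using hone b hb u y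
  · exact sum_nbw_mul_le a x h0 fun u => sum_nbw_mul_le b u h0 fun v => hone c hc v y

theorem sum_shortPath_le {m : ℕ} (hG : HasDegree G m) (hm : 2 ≤ m)
    (hp : p ∈ Set.Icc (0 : ℝ) 1) {T : ℕ} (hq : ∀ t ≤ T, (p * ((m : ℝ) - 1)) ^ t ≤ 2) (x y : V) :
    ∑ u, ∑ v, percProb G p (fun ω => ShortPath ω T x u) *
        percProb G p (fun ω => ShortPath ω T u v) * percProb G p (fun ω => ShortPath ω T v y) ≤
      (if x = y then 1 else 0) + 64 * (27 * (1 / ((m : ℝ) - 1)) + nbwTriple G T x y) := by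
  set R := Finset.range (T + 1) with hR
  let c : ℕ → ℝ := fun t => if t = 0 then 1 else 4
  have hc0 : ∀ t, 0 ≤ c t := fun t => by dsimp only [c]; split_ifs <;> norm_num
  have hc4 : ∀ t, c t ≤ 4 := fun t => by dsimp only [c]; split_ifs <;> norm_num
  have hS : ∀ a b, percProb G p (fun ω => ShortPath ω T a b) ≤ ∑ t ∈ R, c t * nbw G t a b :=
    fun a b => percProb_shortPath_le_sum_nbw hG hm hp hq a b
  have hA : ∀ a b, 0 ≤ ∑ t ∈ R, c t * nbw G t a b := fun a b =>
    Finset.sum_nonneg fun t _ => mul_nonneg (hc0 t) (nbw_nonneg _ _ _)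
  have h1 : ∑ u, ∑ v, percProb G p (fun ω => ShortPath ω T x u) *
        percProb G p (fun ω => ShortPath ω T u v) * percProb G p (fun ω => ShortPath ω T v y) ≤
      ∑ t ∈ R ×ˢ R ×ˢ R, c t.1 * c t.2.1 * c t.2.2 * nbwConv G t x y := by
    calc _ ≤ ∑ u, ∑ v, (∑ t ∈ R, c t * nbw G t x u) * (∑ t ∈ R, c t * nbw G t u v) *
            (∑ t ∈ R, c t * nbw G t v y) := by
          refine Finset.sum_le_sum fun u _ => Finset.sum_le_sum fun v _ => ?_
          exact mul_le_mul (mul_le_mul (hS _ _) (hS _ _) (percProb_nonneg hp _) (hA _ _))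
            (hS _ _) (percProb_nonneg hp _) (mul_nonneg (hA _ _) (hA _ _))
      _ = ∑ u, ∑ v, ∑ t ∈ R ×ˢ R ×ˢ R, c t.1 * c t.2.1 * c t.2.2 *
            (nbw G t.1 x u * nbw G t.2.1 u v * nbw G t.2.2 v y) := by
          refine Finset.sum_congr rfl fun u _ => Finset.sum_congr rfl fun v _ => ?_
          rw [mul_assoc, Finset.sum_mul_sum, ← Finset.sum_product', Finset.sum_mul_sum,
            ← Finset.sum_product']
          exact Finset.sum_congr rfl fun t _ => by ring
      _ = ∑ t ∈ R ×ˢ R ×ˢ R, c t.1 * c t.2.1 * c t.2.2 * nbwConv G t x y := by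
          simp_rw [nbwConv, Finset.mul_sum]
          rw [Finset.sum_congr rfl fun u _ => Finset.sum_comm, Finset.sum_comm]
  have h2 : ∑ t ∈ R ×ˢ R ×ˢ R, c t.1 * c t.2.1 * c t.2.2 * nbwConv G t x y ≤
      (if x = y then 1 else 0) +
        64 * ∑ t ∈ (R ×ˢ R ×ˢ R).erase (0, 0, 0), nbwConv G t x y := by
    rw [← Finset.add_sum_erase _ _ (show ((0, 0, 0) : ℕ × ℕ × ℕ) ∈ R ×ˢ R ×ˢ R by simp [R]),
      nbwConv_zero, Finset.mul_sum]
    refine add_le_add (le_of_eq (by simp [c])) (Finset.sum_le_sum fun t _ => ?_)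
    refine mul_le_mul_of_nonneg_right ?_ (nbwConv_nonneg t x y)
    calc c t.1 * c t.2.1 * c t.2.2 ≤ 4 * 4 * 4 :=
          mul_le_mul (mul_le_mul (hc4 _) (hc4 _) (hc0 _) (by norm_num)) (hc4 _) (hc0 _)
            (by norm_num)
      _ = 64 := by norm_num
  have h3 : ∑ t ∈ (R ×ˢ R ×ˢ R).erase (0, 0, 0), nbwConv G t x y ≤
      27 * (1 / ((m : ℝ) - 1)) + nbwTriple G T x y := by
    rw [nbwTriple_eq_sum_nbwConv, ← Finset.sum_filter_not_add_sum_filter _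
      (fun t : ℕ × ℕ × ℕ => 3 ≤ t.1 + t.2.1 + t.2.2)]
    have hm' : (2 : ℝ) ≤ m := by exact_mod_cast hm
    have h0 : 0 ≤ 1 / ((m : ℝ) - 1) := one_div_nonneg.2 (by linarith)
    refine add_le_add ?_ (Finset.sum_le_sum_of_subset_of_nonneg
      (Finset.filter_subset_filter _ (Finset.erase_subset _ _)) fun t _ _ => nbwConv_nonneg t x y)
    refine (Finset.sum_le_card_nsmul _ _ (1 / ((m : ℝ) - 1)) fun t ht =>
      nbwConv_le hG hm (Finset.ne_of_mem_erase (Finset.mem_of_mem_filter t ht)) x y).trans ?_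
    rw [nsmul_eq_mul]
    refine mul_le_mul_of_nonneg_right ?_ h0
    -- Times with sum at most 2 lie in `{0,1,2}³`, whence the crude count 27.
    have hsub : ((R ×ˢ R ×ˢ R).erase (0, 0, 0)).filter
        (fun t : ℕ × ℕ × ℕ => ¬3 ≤ t.1 + t.2.1 + t.2.2) ⊆
        Finset.range 3 ×ˢ Finset.range 3 ×ˢ Finset.range 3 := by
      intro t ht
      have := (Finset.mem_filter.1 ht).2
      simp only [Finset.mem_product, Finset.mem_range]
      omega
    have hcard := Finset.card_le_card hsub
    simp only [Finset.card_product, Finset.card_range] at hcard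
    exact_mod_cast hcard
  linarith

/-- The quantitative triangle bound. -/
theorem triangle_le {m : ℕ} (htr : IsTransitive G) (hG : HasDegree G m) (hm : 2 ≤ m)
    (hp : p ∈ Set.Icc (0 : ℝ) 1) {T : ℕ} (hT : 1 ≤ T)
    (hq : ∀ t ≤ T, (p * ((m : ℝ) - 1)) ^ t ≤ 2) {δ : ℝ} (hδ : δ ≤ 1)
    (hmix : IsMixingTime G δ T) (o x y : V) :
    triangle G p x y ≤ (if x = y then 1 else 0) +
      48 * chi G o p ^ 3 / (Fintype.card V : ℝ) +
        64 * (27 * (1 / ((m : ℝ) - 1)) + nbwTriple G T x y) := by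
  set B := 16 * chi G o p / (Fintype.card V : ℝ) with hB
  let S : V → V → ℝ := fun a b => percProb G p (fun ω => ShortPath ω T a b)
  let τ : V → V → ℝ := twoPoint G p
  have hS0 : ∀ a b, 0 ≤ S a b := fun a b => percProb_nonneg hp _
  have hτ0 : ∀ a b, 0 ≤ τ a b := fun a b => twoPoint_nonneg hp a b
  have hSτ : ∀ a b, S a b ≤ τ a b := fun a b =>
    percProb_mono hp fun ω _ h => h.connects
  have hτS : ∀ a b, τ a b ≤ S a b + B := fun a b => by
    have h1 : τ a b ≤ S a b + percProb G p (fun ω => LongPath ω (T + 1) a b) := by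
      refine (percProb_le_sum hp Finset.univ (B := fun (i : Bool) ω =>
        if i then ShortPath ω T a b else LongPath ω (T + 1) a b) fun ω _ h => ?_).trans_eq ?_
      · rcases h.shortPath_or_longPath T with h | h
        · exact ⟨true, Finset.mem_univ _, by simpa using h⟩
        · exact ⟨false, Finset.mem_univ _, by simpa using h⟩
      · simp [S]
    have h2 := percProb_longPath_le_chi_div_card hG hm hp hT hq hδ hmix a b
    rw [chi_eq_of_isTransitive htr p a o] at h2
    linarith
  -- The factors are replaced one at a time by `τ ≤ S + B`; in each error term the factors `S`
  -- already present are bounded back by `τ`, so that it sums to `B χ²`.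
  have hterm : ∀ u v, τ x u * τ u v * τ v y ≤ S x u * S u v * S v y +
      (B * (τ u v * τ v y) + B * (τ x u * τ v y) + B * (τ x u * τ u v)) := fun u v => by
    have hB0 : 0 ≤ B := by
      have : 0 ≤ chi G o p := by
        rw [← sum_twoPoint]
        exact Finset.sum_nonneg fun z _ => twoPoint_nonneg hp o z
      positivity
    have e1 : τ x u * τ u v * τ v y ≤ S x u * (τ u v * τ v y) + B * (τ u v * τ v y) := by
      have := mul_le_mul_of_nonneg_right (hτS x u) (mul_nonneg (hτ0 u v) (hτ0 v y))
      linarith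
    have e2 : S x u * (τ u v * τ v y) ≤ S x u * S u v * τ v y + B * (τ x u * τ v y) := by
      have a1 := mul_le_mul_of_nonneg_left (hτS u v) (mul_nonneg (hS0 x u) (hτ0 v y))
      have a2 := mul_le_mul_of_nonneg_right (hSτ x u) (mul_nonneg hB0 (hτ0 v y))
      linarith
    have e3 : S x u * S u v * τ v y ≤ S x u * S u v * S v y + B * (τ x u * τ u v) := by
      have a1 := mul_le_mul_of_nonneg_left (hτS v y) (mul_nonneg (hS0 x u) (hS0 u v))
      have a2 := mul_le_mul_of_nonneg_left
        (mul_le_mul (hSτ x u) (hSτ u v) (hS0 u v) (hτ0 x u)) hB0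
      linarith
    linarith
  have hrow : ∀ a, ∑ b, τ a b = chi G o p := fun a => by
    rw [← chi_eq_of_isTransitive htr p a o]
    exact sum_twoPoint G p a
  have hcol : ∀ b, ∑ a, τ a b = chi G o p := fun b => by
    rw [← hrow b]
    exact Finset.sum_congr rfl fun a _ => twoPoint_comm G p a b
  have s1 : ∑ u, ∑ v, B * (τ u v * τ v y) = B * chi G o p ^ 2 := by
    rw [Finset.sum_comm]
    simp_rw [← Finset.mul_sum, ← Finset.sum_mul, hcol, ← Finset.mul_sum, hcol]
    ring
  have s2 : ∑ u, ∑ v, B * (τ x u * τ v y) = B * chi G o p ^ 2 := by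
    simp_rw [← Finset.mul_sum, hcol, ← Finset.sum_mul, hrow]
    ring
  have s3 : ∑ u, ∑ v, B * (τ x u * τ u v) = B * chi G o p ^ 2 := by
    simp_rw [← Finset.mul_sum, hrow, ← Finset.sum_mul, hrow]
    ring
  have hshort := sum_shortPath_le hG hm hp hq x y
  have hsum : triangle G p x y ≤ ∑ u, ∑ v, (S x u * S u v * S v y +
      (B * (τ u v * τ v y) + B * (τ x u * τ v y) + B * (τ x u * τ u v))) :=
    Finset.sum_le_sum fun u _ => Finset.sum_le_sum fun v _ => hterm u v
  simp_rw [Finset.sum_add_distrib] at hsum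
  rw [s1, s2, s3] at hsum
  have hB3 : B * chi G o p ^ 2 + B * chi G o p ^ 2 + B * chi G o p ^ 2 =
      48 * chi G o p ^ 3 / (Fintype.card V : ℝ) := by rw [hB]; ring
  linarith

theorem HasDegree.lt_card {m : ℕ} (hG : HasDegree G m) (x : V) : m < Fintype.card V := by
  rw [← hG.card_neighborFinset x]
  exact Finset.card_lt_univ_of_notMem (x := x) (by simp)

/-- At time 0 the averaged return probability is at least `1/2`, while mixing would force it to be
at most `2/V < 1/2`. -/
theorem IsMixingTime.one_le {m : ℕ} (hG : HasDegree G m) (hm : 4 ≤ m) {δ : ℝ} (hδ : δ ≤ 1)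
    {T : ℕ} (hmix : IsMixingTime G δ T) (x : V) : 1 ≤ T := by
  by_contra h
  obtain rfl : T = 0 := by omega
  have h1 := hmix.1 x x
  have h2 := nbw_nonneg (G := G) (0 + 1) x x
  have h3 : nbw G 0 x x = 1 := by simp [nbw]
  have hV : (4 : ℝ) < Fintype.card V := by exact_mod_cast hm.trans_lt (hG.lt_card x)
  have h4 : (1 + δ) * (Fintype.card V : ℝ)⁻¹ < 1 / 2 := by
    rw [← div_eq_mul_inv, div_lt_iff₀ (by linarith)]
    linarith
  linarith

/-- Carries the control of `[p_c(m-1)]^T` to all `p ≤ p_c` and all exponents up to `T`. -/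
theorem pow_le_two_of_pow_le_two {q b : ℝ} (hq : 0 ≤ q) (hqb : q ≤ b) {T : ℕ} (hb : b ^ T ≤ 2)
    {t : ℕ} (ht : t ≤ T) : q ^ t ≤ 2 := by
  rcases le_total q 1 with h | h
  · exact (pow_le_one₀ hq h).trans one_le_two
  · exact (pow_le_pow_right₀ h ht).trans ((pow_le_pow_left₀ hq hqb T).trans hb)

end Triangle

end FiniteGraph

/-! ### Passage to the limit. -/

open Classical in
theorem theorem1p5 :
    ∃ C : ℝ, 0 < C ∧
      ∀ (V : ℕ → Type*) [∀ n, Fintype (V n)]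
        (G : (n : ℕ) → SimpleGraph (V n)) (o : (n : ℕ) → V n)
        (m : ℕ → ℕ) (δ : ℕ → ℝ) (T : ℕ → ℕ) (pc : ℕ → ℝ),
        (∀ n, FiniteGraph.IsTransitive (G n)) →
        (∀ n, FiniteGraph.HasDegree (G n) (m n)) →
        (∀ᶠ n in atTop, FiniteGraph.IsCriticalProb (G n) (o n) (1 / 10) (pc n)) →
        Tendsto δ atTop (𝓝 0) →
        (∀ᶠ n in atTop, FiniteGraph.IsMixingTime (G n) (δ n) (T n)) →
        Tendsto m atTop atTop →
        Tendsto (fun n => (pc n * ((m n : ℝ) - 1)) ^ T n) atTop (𝓝 1) →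
        (∀ ε : ℝ, 0 < ε → ∀ᶠ n in atTop, ∀ x y : V n,
          FiniteGraph.nbwTriple (G n) (T n) x y ≤ ε / Real.log (Fintype.card (V n))) →
        ∃ err : ℕ → ℝ, Tendsto err atTop (𝓝 0) ∧
          ∀ᶠ n in atTop, ∀ p ∈ Set.Icc (0 : ℝ) (pc n), ∀ x y : V n,
            FiniteGraph.triangle (G n) p x y ≤
              (if x = y then 1 else 0) +
                C * FiniteGraph.chi (G n) (o n) p ^ 3 / (Fintype.card (V n) : ℝ) + err n := by
  refine ⟨48, by norm_num, ?_⟩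
  intro V _ G o m δ T pc htr hdeg hcrit hδ hmix hm hpow htriple
  -- A supremum over pairs, so that the error term does not depend on `x` and `y`.
  let M : ℕ → ℝ := fun n => ⨆ z : V n × V n, FiniteGraph.nbwTriple (G n) (T n) z.1 z.2
  have hM : ∀ n x y, FiniteGraph.nbwTriple (G n) (T n) x y ≤ M n := fun n x y =>
    le_ciSup (f := fun z : V n × V n => FiniteGraph.nbwTriple (G n) (T n) z.1 z.2)
      (Set.finite_range _).bddAbove (x, y)
  have hM0 : ∀ n, 0 ≤ M n := fun n => by
    refine le_trans ?_ (hM n (o n) (o n))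
    rw [FiniteGraph.nbwTriple_eq_sum_nbwConv]
    exact Finset.sum_nonneg fun t _ => FiniteGraph.nbwConv_nonneg t _ _
  have hMlim : Tendsto M atTop (𝓝 0) := by
    rw [Metric.tendsto_nhds]
    intro ε hε
    filter_upwards [htriple (ε / 2) (half_pos hε), hm.eventually_ge_atTop 2] with n hn hmn
    rw [Real.dist_0_eq_abs, abs_of_nonneg (hM0 n)]
    have : Nonempty (V n) := ⟨o n⟩
    refine lt_of_le_of_lt (ciSup_le fun z => (hn z.1 z.2).trans ?_) (half_lt_self hε)
    -- Since `V ≥ 3 > e`, `log V ≥ 1`, and division by it can be dropped.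
    have hV : (3 : ℝ) ≤ Fintype.card (V n) := by
      exact_mod_cast hmn.trans_lt ((hdeg n).lt_card (o n))
    refine div_le_self (half_pos hε).le ?_
    rw [Real.le_log_iff_exp_le (by linarith)]
    exact (Real.exp_one_lt_d9.le.trans (by norm_num)).trans hV
  have hmlim : Tendsto (fun n => 1 / ((m n : ℝ) - 1)) atTop (𝓝 0) := by
    simp_rw [one_div]
    exact tendsto_inv_atTop_zero.comp
      (tendsto_atTop_add_const_right _ (-1) (tendsto_natCast_atTop_atTop.comp hm))
  refine ⟨fun n => 64 * (27 * (1 / ((m n : ℝ) - 1)) + M n), ?_, ?_⟩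
  · simpa using ((hmlim.const_mul 27).add hMlim).const_mul 64
  · filter_upwards [hcrit, hδ.eventually_le_const zero_lt_one, hmix,
      hm.eventually_ge_atTop 4, hpow.eventually_le_const one_lt_two] with n hc hδn hmixn hmn hpown
    intro p hp x y
    have hm' : (4 : ℝ) ≤ m n := by exact_mod_cast hmn
    have hq0 : 0 ≤ p * ((m n : ℝ) - 1) := mul_nonneg hp.1 (by linarith)
    have hqb : p * ((m n : ℝ) - 1) ≤ pc n * ((m n : ℝ) - 1) :=
      mul_le_mul_of_nonneg_right hp.2 (by linarith)
    have key := FiniteGraph.triangle_le (htr n) (hdeg n) (by omega)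
      ⟨hp.1, hp.2.trans hc.1.2⟩ (hmixn.one_le (hdeg n) hmn hδn (o n))
      (fun t ht => FiniteGraph.pow_le_two_of_pow_le_two hq0 hqb hpown ht) hδn hmixn (o n) x y
    have := hM n x y
    linarith
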